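/- Throw $m$ balls independently and uniformly at random into $n$ bins, and let $w_1\le\dots\le w_n$ be the numbers of balls in the bins, sorted in non-decreasing order. For a real quota $q$, consider the weighted voting game on $\{1,\dots,n\}$ in which a set $S$ has value $v(S)=1$ if $\sum_{i\in S}w_i\ge q$ and $v(S)=0$ otherwise, and let $$\varphi_i=\frac1{n!}\sum_{\sigma\in S_n}\bigl(v(P_i(\sigma)\cup\{i\})-v(P_i(\sigma))\bigr),\qquad P_i(\sigma)=\{j:\sigma(j)<\sigma(i)\},$$ be the Shapley value of agent $i$, so that $\varphi_1$ is the Shapley value of the agent of least weight. Theorem. Let $q=\ell\cdot\frac mn$ with $\ell\in\{1,\dots,n\}$ and $\gamma\le\frac{\ell}{n}\le 1-\gamma$ for some constant $\gamma>0$. Then for $m=\Omega(n^3)$, $$\mathbb E[\varphi_1]\ \ge\ \frac1n-O_\gamma\!\left(\sqrt{\frac{\log n}{n^3}}\right).$$ Explicitly: for every $\gamma>0$ there is a constant $K=K(\gamma)$ such that for every $c>0$ there is $N=N(\gamma,c)$ such that for all $n\ge N$ with $n \geq 1$, all integers $m\ge c\,n^3$ and all $\ell\in\{1,\dots,n\}$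 with $\gamma\le \ell/n\le 1-\gamma$, the game with quota $q=\ell m/n$ satisfies $\mathbb E[\varphi_1]\ge \frac1n-K\sqrt{\log n/n^3}$. -/

import Mathlib

open scoped Nat

/-! ### Weighted voting games and the Shapley value -/

/-- The total weight `w(S)` of a coalition `S` of agents. -/
def coalitionWeight {n : ℕ} (w : Fin n → ℝ) (S : Finset (Fin n)) : ℝ :=
  ∑ i ∈ S, w i

open Classical in
/-- The value of a coalition in the weighted voting game with weights `w` and quota `q`:
`1` if it is winning (`w(S) ≥ q`) and `0` otherwise. -/
noncomputable def gameValue {n : ℕ} (w : Fin n → ℝ) (q : ℝ) (S : Finset (Fin n)) : ℝ :=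
  if q ≤ coalitionWeight w S then 1 else 0

/-- The marginal contribution `m_i(S) = v(S ∪ {i}) - v(S)` of agent `i` to `S`. -/
noncomputable def marginal {n : ℕ} (w : Fin n → ℝ) (q : ℝ) (i : Fin n)
    (S : Finset (Fin n)) : ℝ :=
  gameValue w q (insert i S) - gameValue w q S

/-- The set `P_i(σ) = {j : σ(j) < σ(i)}` of predecessors of agent `i` in the ordering `σ`. -/
def predecessors {n : ℕ} (σ : Equiv.Perm (Fin n)) (i : Fin n) : Finset (Fin n) :=
  Finset.univ.filter (fun j => σ j < σ i)

/-- The Shapley value `φ_i = (1/n!) ∑_σ m_i(P_i(σ))` of agent `i` in the weighted voting game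
with weights `w` and quota `q`. -/
noncomputable def shapley {n : ℕ} (w : Fin n → ℝ) (q : ℝ) (i : Fin n) : ℝ :=
  (1 / (n ! : ℝ)) * ∑ σ : Equiv.Perm (Fin n), marginal w q i (predecessors σ i)

/-! ### The uniform balls and bins process

An outcome is a function `f : Fin m → Fin n` that sends each ball to its bin. Throwing the `m`
balls independently and uniformly makes all `n ^ m` outcomes equally likely. -/

/-- The number of balls in each bin. -/
def binLoad {m n : ℕ} (f : Fin m → Fin n) (i : Fin n) : ℕ :=
  (Finset.univ.filter (fun b => f b = i)).card

/-- The agents' weights: the bin loads, sorted in non-decreasing order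
(so agent `0` is the one with the least weight). -/
def sortedWeights {m n : ℕ} (f : Fin m → Fin n) (i : Fin n) : ℝ :=
  (binLoad f (Tuple.sort (binLoad f) i) : ℝ)

/-- The expectation of a random variable over the uniform balls and bins process with
`m` balls and `n` bins. -/
noncomputable def ballsBinsExpectation {m n : ℕ} (X : (Fin m → Fin n) → ℝ) : ℝ :=
  (1 / (n : ℝ) ^ m) * ∑ f : Fin m → Fin n, X f

/-! Let `i` be the least agent, `T` the first `ℓ` agents of an ordering in which `i` comes last
among them, and exchange `i` with its successor. If the loads differ by at most `δ`, then `i` is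
pivotal before or after the exchange, unless `w(T)` lies in `[q - δ, q)` or is at least about one
bin load away from `q`. As `i` takes each position with probability `1/n`, this gives `φ ≥ 1/n`
minus the weight of the exceptional orderings (`shapley_ge`).

The identity of `i` depends on the throw. Forgetting that `T` contains `i` costs a factor `n/ℓ ≤
1/γ` (`shapley_sortedWeights_ge`). Then `T` is independent of the throw, and its load is binomial
with mean exactly `q = ℓm/n`. A Fourier estimate bounds each point mass by `O(1/√m)`
(`card_setLoad_eq_le`), and Chernoff's bound handles large deviations. With high probability all
loads are within `O(√(m log n / n))` of `m/n`, so the relative loss is `O(√(log n / n))`. -/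

/-! ### Orderings of the agents -/

/-- The first `ℓ` agents in the ordering `σ`. -/
def initialSegment {n : ℕ} (σ : Equiv.Perm (Fin n)) (ℓ : ℕ) : Finset (Fin n) :=
  Finset.univ.filter (fun j => (σ j : ℕ) < ℓ)

theorem mem_initialSegment {n : ℕ} {σ : Equiv.Perm (Fin n)} {ℓ : ℕ} {j : Fin n} :
    j ∈ initialSegment σ ℓ ↔ (σ j : ℕ) < ℓ := by
  simp [initialSegment]

theorem card_initialSegment {n : ℕ} (σ : Equiv.Perm (Fin n)) {ℓ : ℕ} (hℓ : ℓ ≤ n) :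
    (initialSegment σ ℓ).card = ℓ := by
  have h : (initialSegment σ ℓ).map σ.toEmbedding =
      Finset.univ.filter (fun j : Fin n => (j : ℕ) < ℓ) := by
    ext x
    simp only [Finset.mem_map_equiv, mem_initialSegment, Finset.mem_filter, Finset.mem_univ,
      true_and, Equiv.apply_symm_apply]
  rw [← Finset.card_map σ.toEmbedding, h, Fin.card_filter_val_lt, min_eq_right hℓ]

theorem initialSegment_swap_mul {n : ℕ} (σ : Equiv.Perm (Fin n)) {ℓ : ℕ} {r s : Fin n}
    (hr : (r : ℕ) < ℓ) (hs : (s : ℕ) < ℓ) :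
    initialSegment (Equiv.swap r s * σ) ℓ = initialSegment σ ℓ := by
  ext j
  rw [mem_initialSegment, mem_initialSegment, Equiv.Perm.mul_apply, Equiv.swap_apply_def]
  split_ifs with h1 h2 <;> simp_all

open Classical in
/-- If the initial segment of length `ℓ` contains `a`, then all `ℓ` positions of `a` in it are
equally likely. -/
theorem mul_card_position_eq {n : ℕ} (Q : Finset (Fin n) → Prop) (a r : Fin n) {ℓ : ℕ}
    (hr : (r : ℕ) < ℓ) (hℓ : ℓ ≤ n) :
    ℓ * (Finset.univ.filter (fun τ : Equiv.Perm (Fin n) =>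
        τ a = r ∧ Q (initialSegment τ ℓ))).card =
      (Finset.univ.filter (fun τ : Equiv.Perm (Fin n) =>
        (τ a : ℕ) < ℓ ∧ Q (initialSegment τ ℓ))).card := by
  refine Eq.symm ?_
  rw [Finset.card_eq_sum_card_fiberwise (f := fun τ => τ a)
    (t := Finset.univ.filter (fun j : Fin n => (j : ℕ) < ℓ))
    (fun τ hτ => Finset.mem_filter.2 ⟨Finset.mem_univ _, (Finset.mem_filter.1 hτ).2.1⟩),
    Finset.sum_const_nat (m := (Finset.univ.filter (fun τ : Equiv.Perm (Fin n) =>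
        τ a = r ∧ Q (initialSegment τ ℓ))).card), Fin.card_filter_val_lt, min_eq_right hℓ]
  intro s hs
  have hs' : (s : ℕ) < ℓ := by simpa using hs
  -- Exchanging positions `r` and `s`, both below `ℓ`, moves `a` from `s` to `r` and preserves the
  -- initial segment.
  refine Finset.card_bij' (fun τ _ => Equiv.swap r s * τ) (fun τ _ => Equiv.swap r s * τ)
    ?_ ?_ ?_ ?_
  · intro τ hτ
    simp only [Finset.mem_filter, Finset.mem_univ, true_and] at hτ ⊢
    rw [initialSegment_swap_mul τ hr hs', Equiv.Perm.mul_apply, hτ.2]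
    exact ⟨by simp, hτ.1.2⟩
  · intro τ hτ
    simp only [Finset.mem_filter, Finset.mem_univ, true_and] at hτ ⊢
    rw [initialSegment_swap_mul τ hr hs', Equiv.Perm.mul_apply, hτ.1]
    exact ⟨⟨by simpa using hs', hτ.2⟩, by simp⟩
  · intro τ _
    rw [← mul_assoc, Equiv.swap_mul_self, one_mul]
  · intro τ _
    rw [← mul_assoc, Equiv.swap_mul_self, one_mul]

theorem mul_card_position {n : ℕ} (a r : Fin n) :
    n * (Finset.univ.filter (fun τ : Equiv.Perm (Fin n) => τ a = r)).card = n ! := by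
  have h := mul_card_position_eq (fun _ => True) a r r.isLt le_rfl
  simpa [Fintype.card_perm] using h

/-! ### The Shapley value of a least agent -/

theorem gameValue_eq_one {n : ℕ} {w : Fin n → ℝ} {q : ℝ} {S : Finset (Fin n)}
    (h : q ≤ coalitionWeight w S) : gameValue w q S = 1 := if_pos h

theorem gameValue_eq_zero {n : ℕ} {w : Fin n → ℝ} {q : ℝ} {S : Finset (Fin n)}
    (h : coalitionWeight w S < q) : gameValue w q S = 0 := if_neg h.not_ge

theorem marginal_nonneg {n : ℕ} {w : Fin n → ℝ} (hw : ∀ i, 0 ≤ w i) (q : ℝ) (i : Fin n)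
    (S : Finset (Fin n)) : 0 ≤ marginal w q i S := by
  have h : coalitionWeight w S ≤ coalitionWeight w (insert i S) :=
    Finset.sum_le_sum_of_subset_of_nonneg (Finset.subset_insert i S) (fun j _ _ => hw j)
  unfold marginal
  rcases lt_or_ge (coalitionWeight w S) q with h1 | h1
  · rw [gameValue_eq_zero h1, sub_zero]
    unfold gameValue
    split_ifs <;> norm_num
  · rw [gameValue_eq_one h1, gameValue_eq_one (h1.trans h), sub_self]

theorem shapley_nonneg {n : ℕ} {w : Fin n → ℝ} (hw : ∀ i, 0 ≤ w i) (q : ℝ) (i : Fin n) :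
    0 ≤ shapley w q i :=
  mul_nonneg (by positivity) (Finset.sum_nonneg fun _ _ => marginal_nonneg hw q i _)

theorem coalitionWeight_insert {n : ℕ} (w : Fin n → ℝ) {S : Finset (Fin n)} {i : Fin n}
    (h : i ∉ S) : coalitionWeight w (insert i S) = w i + coalitionWeight w S :=
  Finset.sum_insert h

theorem marginal_eq_one {n : ℕ} {w : Fin n → ℝ} {q : ℝ} {i : Fin n} {S : Finset (Fin n)}
    (h1 : q ≤ coalitionWeight w (insert i S)) (h2 : coalitionWeight w S < q) :
    marginal w q i S = 1 := by
  rw [marginal, gameValue_eq_one h1, gameValue_eq_zero h2, sub_zero]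

/-- The weight `x` of a coalition lies just below the quota, or far from it. -/
def CriticalWeight (q δ η x : ℝ) : Prop :=
  (q - δ ≤ x ∧ x < q) ∨ η ≤ |x - q|

open Classical in
/-- Two orderings that differ by exchanging the agent `i` at position `ℓ - 1` with its successor:
`i` is pivotal in one of them, unless the first `ℓ` agents have critical weight. -/
theorem one_sub_critical_le_marginal_add {n : ℕ} {w : Fin n → ℝ} (hw : ∀ i, 0 ≤ w i)
    {q δ η : ℝ} {i r s : Fin n} (hmin : ∀ j, w i ≤ w j) (hδ : ∀ j, w j - w i ≤ δ)
    (hη : η ≤ w i) (hrs : (s : ℕ) = r + 1) (σ : Equiv.Perm (Fin n)) (hσ : σ i = r) :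
    1 - (if CriticalWeight q δ η (coalitionWeight w (initialSegment σ s)) then (1 : ℝ) else 0) ≤
      marginal w q i (predecessors σ i) +
        marginal w q i (predecessors (Equiv.swap r s * σ) i) := by
  have n1 := marginal_nonneg hw q i (predecessors σ i)
  have n2 := marginal_nonneg hw q i (predecessors (Equiv.swap r s * σ) i)
  split_ifs with hc
  · linarith
  have hi : i ∉ predecessors σ i := by simp [predecessors]
  have hT : initialSegment σ s = insert i (predecessors σ i) := by
    ext j
    rw [mem_initialSegment, Finset.mem_insert, predecessors, Finset.mem_filter, hσ,
      ← σ.injective.eq_iff, hσ, Fin.ext_iff, Fin.lt_def]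
    simp only [Finset.mem_univ, true_and]
    omega
  have hj : σ (σ.symm s) = s := σ.apply_symm_apply s
  have hjP : σ.symm s ∉ predecessors σ i := by
    simp only [predecessors, Finset.mem_filter, Finset.mem_univ, true_and, hj, hσ, Fin.lt_def]
    omega
  have hT' : predecessors (Equiv.swap r s * σ) i = insert (σ.symm s) (predecessors σ i) := by
    ext j
    simp only [Finset.mem_insert, predecessors, Finset.mem_filter, Finset.mem_univ, true_and,
      Equiv.Perm.mul_apply, hσ, Equiv.swap_apply_left, Equiv.eq_symm_apply]
    rw [Equiv.swap_apply_def]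
    split_ifs with h1 h2
    · simp only [Fin.ext_iff, Fin.lt_def, h1]; omega
    · simp only [h2, true_or, iff_true, Fin.lt_def]; omega
    · simp only [h2, false_or, Fin.lt_def]
      have h1' : (σ j : ℕ) ≠ r := fun h => h1 (Fin.ext h)
      omega
  have hij : i ∉ insert (σ.symm s) (predecessors σ i) := by
    rw [Finset.mem_insert, not_or]
    refine ⟨fun h => ?_, hi⟩
    rw [h, hj] at hσ
    rw [hσ] at hrs
    omega
  unfold CriticalWeight at hc
  rw [hT, coalitionWeight_insert w hi] at hc
  push Not at hc
  obtain ⟨hc1, hc2⟩ := hc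
  rw [abs_lt] at hc2
  -- If `w(T) ≥ q`, then `i` is pivotal in `σ`, since removing it loses at least `η`. Otherwise
  -- `w(T) < q - δ`: replacing `i` by its successor stays below `q`, and adding `i` back gains at
  -- least `η`.
  rcases le_or_gt q (w i + coalitionWeight w (predecessors σ i)) with h | h
  · have := marginal_eq_one (w := w) (q := q) (i := i) (S := predecessors σ i)
      (by rwa [coalitionWeight_insert w hi]) (by linarith [hc2.2])
    linarith
  · have h3 : w i + coalitionWeight w (predecessors σ i) < q - δ := by
      by_contra h4
      linarith [hc1 (not_lt.1 h4)]
    have := marginal_eq_one (w := w) (q := q) (i := i)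
      (S := predecessors (Equiv.swap r s * σ) i)
      (by rw [hT', coalitionWeight_insert w hij, coalitionWeight_insert w hjP]
          linarith [hmin (σ.symm s), hc2.1])
      (by rw [hT', coalitionWeight_insert w hjP]; linarith [hδ (σ.symm s)])
    linarith

-- Only the orderings with `i` at `r` or `s` are kept. The exchange pairs them off, and each
-- noncritical pair contributes at least 1.
open Classical in
theorem shapley_ge {n : ℕ} {w : Fin n → ℝ} (hw : ∀ i, 0 ≤ w i)
    {q δ η : ℝ} {i r s : Fin n} (hmin : ∀ j, w i ≤ w j) (hδ : ∀ j, w j - w i ≤ δ)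
    (hη : η ≤ w i) (hrs : (s : ℕ) = r + 1) :
    1 / (n : ℝ) - 1 / (n ! : ℝ) * ((Finset.univ.filter (fun σ : Equiv.Perm (Fin n) => σ i = r ∧
      CriticalWeight q δ η (coalitionWeight w (initialSegment σ s)))).card : ℝ) ≤
        shapley w q i := by
  have hn : (0 : ℝ) < n := by exact_mod_cast r.pos
  have hne : r ≠ s := fun h => by rw [h] at hrs; omega
  set A := Finset.univ.filter (fun σ : Equiv.Perm (Fin n) => σ i = r)
  have hA : (n : ℝ) * A.card = (n ! : ℝ) := by exact_mod_cast mul_card_position i r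
  have hfac : (0 : ℝ) < n ! := by exact_mod_cast n.factorial_pos
  have key : (A.card : ℝ) - ((Finset.univ.filter (fun σ : Equiv.Perm (Fin n) => σ i = r ∧
      CriticalWeight q δ η (coalitionWeight w (initialSegment σ s)))).card : ℝ) ≤
      ∑ σ : Equiv.Perm (Fin n), marginal w q i (predecessors σ i) := by
    calc _ = ∑ σ ∈ A, (1 - (if CriticalWeight q δ η
            (coalitionWeight w (initialSegment σ s)) then (1 : ℝ) else 0)) := by
          rw [Finset.sum_sub_distrib, Finset.sum_boole, Finset.sum_const, nsmul_eq_mul, mul_one,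
            Finset.filter_filter]
      _ ≤ ∑ σ ∈ A, (marginal w q i (predecessors σ i) +
            marginal w q i (predecessors (Equiv.swap r s * σ) i)) :=
          Finset.sum_le_sum fun σ hσ => one_sub_critical_le_marginal_add hw hmin hδ hη hrs σ
            (Finset.mem_filter.1 hσ).2
      _ = ∑ σ ∈ A, marginal w q i (predecessors σ i) +
            ∑ σ ∈ Finset.univ.filter (fun σ : Equiv.Perm (Fin n) => σ i = s),
              marginal w q i (predecessors σ i) := by
          rw [Finset.sum_add_distrib]
          congr 1
          refine Finset.sum_bij' (fun τ _ => Equiv.swap r s * τ)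
            (fun τ _ => Equiv.swap r s * τ) ?_ ?_ ?_ ?_ ?_
          · intro τ hτ; simp [A] at hτ ⊢; simp [hτ]
          · intro τ hτ; simp [A] at hτ ⊢; simp [hτ]
          · intro τ _; rw [← mul_assoc, Equiv.swap_mul_self, one_mul]
          · intro τ _; rw [← mul_assoc, Equiv.swap_mul_self, one_mul]
          · intro τ _; rfl
      _ ≤ _ := by
          rw [← Finset.sum_union]
          · exact Finset.sum_le_sum_of_subset_of_nonneg (Finset.subset_univ _)
              fun σ _ _ => marginal_nonneg hw q i _
          · rw [Finset.disjoint_filter]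
            intro σ _ h1 h2
            exact hne (h1.symm.trans h2)
  have h1 : (1 : ℝ) / n = 1 / (n ! : ℝ) * A.card := by
    rw [← hA]
    have : (A.card : ℝ) ≠ 0 := fun h => by rw [h, mul_zero] at hA; linarith
    field_simp
  rw [h1, ← mul_sub]
  exact mul_le_mul_of_nonneg_left key (by positivity)

/-! ### The number of balls in a set of bins -/

/-- The number of balls in the bins of `T`. -/
def setLoad {m n : ℕ} (f : Fin m → Fin n) (T : Finset (Fin n)) : ℕ :=
  (Finset.univ.filter (fun b => f b ∈ T)).card

theorem setLoad_singleton {m n : ℕ} (f : Fin m → Fin n) (i : Fin n) :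
    setLoad f {i} = binLoad f i := by
  simp [setLoad, binLoad]

theorem setLoad_eq_sum {m n : ℕ} (f : Fin m → Fin n) (T : Finset (Fin n)) :
    setLoad f T = ∑ i ∈ T, binLoad f i := by
  rw [setLoad, Finset.card_eq_sum_card_fiberwise (f := f) (t := T)
    (s := Finset.univ.filter (fun b => f b ∈ T)) (fun b hb => (Finset.mem_filter.1 hb).2)]
  refine Finset.sum_congr rfl fun i hi => ?_
  rw [binLoad, Finset.filter_filter]
  congr 1
  ext b
  simp only [Finset.mem_filter, Finset.mem_univ, true_and]
  exact ⟨fun h => h.2, fun h => ⟨h ▸ hi, h⟩⟩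

/-- The generating function of the number of balls in the bins of `T`. -/
theorem sum_pow_setLoad {R : Type*} [CommRing R] {m n : ℕ} (T : Finset (Fin n)) (g : R) :
    ∑ f : Fin m → Fin n, g ^ setLoad f T = ((n : R) - T.card + T.card * g) ^ m := by
  have h1 : ∑ i : Fin n, (if i ∈ T then g else 1) = (n : R) - T.card + T.card * g := by
    have h2 : ∀ i : Fin n, (if i ∈ T then g else 1) = 1 + (if i ∈ T then g - 1 else 0) := by
      intro i
      split_ifs <;> ring
    simp only [h2, Finset.sum_add_distrib, Finset.sum_ite_mem, Finset.univ_inter,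
      Finset.sum_const, nsmul_eq_mul, Finset.card_univ, Fintype.card_fin]
    ring
  rw [← h1]
  have h3 := Finset.prod_univ_sum (fun _ : Fin m => (Finset.univ : Finset (Fin n)))
    (fun _ i => if i ∈ T then g else 1)
  rw [Finset.prod_const, Finset.card_univ, Fintype.card_fin, Fintype.piFinset_univ] at h3
  rw [h3]
  refine Finset.sum_congr rfl fun f _ => ?_
  rw [Finset.prod_ite, Finset.prod_const, Finset.prod_const_one, mul_one, setLoad]

/-- The moment generating function bound, scaled by the number `n ^ m` of outcomes. It follows from
`1 + x ≤ exp x` and from `exp s - 1 - s ≤ s ^ 2` for `|s| ≤ 1`. -/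
theorem sum_exp_setLoad_le {m n : ℕ} (hn : 0 < n) (T : Finset (Fin n)) {s : ℝ} (hs : |s| ≤ 1) :
    ∑ f : Fin m → Fin n, Real.exp (s * (setLoad f T - (T.card : ℝ) / n * m)) ≤
      (n : ℝ) ^ m * Real.exp ((T.card : ℝ) / n * m * s ^ 2) := by
  have hn' : (0 : ℝ) < n := by exact_mod_cast hn
  set p : ℝ := (T.card : ℝ) / n
  have hp : 0 ≤ p := by positivity
  have hT : (T.card : ℝ) = n * p := by simp only [p]; field_simp
  have hTn : (T.card : ℝ) ≤ n := by exact_mod_cast (by simpa using T.card_le_univ)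
  have h1 : ∀ f : Fin m → Fin n, Real.exp (s * (setLoad f T - p * m)) =
      Real.exp s ^ setLoad f T * Real.exp (-(s * p)) ^ m := by
    intro f
    rw [← Real.exp_nat_mul, ← Real.exp_nat_mul, ← Real.exp_add]
    congr 1
    ring
  simp only [h1]
  rw [← Finset.sum_mul, sum_pow_setLoad, ← mul_pow]
  have h2 : (n : ℝ) ^ m * Real.exp (p * m * s ^ 2) = (n * Real.exp (p * s ^ 2)) ^ m := by
    rw [mul_pow, ← Real.exp_nat_mul]
    congr 2
    ring
  rw [h2]
  have h3 := Real.exp_pos s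
  refine pow_le_pow_left₀ (mul_nonneg (by nlinarith) (Real.exp_pos _).le) ?_ m
  have h4 := (abs_le.1 (Real.abs_exp_sub_one_sub_id_le hs)).2
  calc ((n : ℝ) - T.card + T.card * Real.exp s) * Real.exp (-(s * p))
      = n * ((p * (Real.exp s - 1) + 1) * Real.exp (-(s * p))) := by rw [hT]; ring
    _ ≤ n * (Real.exp (p * (Real.exp s - 1)) * Real.exp (-(s * p))) := by
        gcongr
        exact Real.add_one_le_exp _
    _ ≤ n * Real.exp (p * s ^ 2) := by
        rw [← Real.exp_add]
        gcongr
        nlinarith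

open Classical in
/-- Chernoff's bound for the number of balls in the bins of `T`. -/
theorem card_setLoad_tail_le {m n : ℕ} (hn : 0 < n) (T : Finset (Fin n)) {s t : ℝ}
    (hs0 : 0 ≤ s) (hs : s ≤ 1) :
    ((Finset.univ.filter (fun f : Fin m → Fin n =>
      t ≤ |(setLoad f T : ℝ) - (T.card : ℝ) / n * m|)).card : ℝ) ≤
      (n : ℝ) ^ m * (2 * Real.exp ((T.card : ℝ) / n * m * s ^ 2 - s * t)) := by
  set x : (Fin m → Fin n) → ℝ := fun f => (setLoad f T : ℝ) - (T.card : ℝ) / n * m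
  have h1 := sum_exp_setLoad_le (m := m) hn T (s := s) (by rwa [abs_of_nonneg hs0])
  have h2 := sum_exp_setLoad_le (m := m) hn T (s := -s) (by rwa [abs_neg, abs_of_nonneg hs0])
  rw [neg_sq] at h2
  -- Markov's inequality for both tails at once, as `exp (s|x|)` is one of the two summands.
  have h3 : ((Finset.univ.filter (fun f => t ≤ |x f|)).card : ℝ) * Real.exp (s * t) ≤
      ∑ f, (Real.exp (s * x f) + Real.exp (-s * x f)) := by
    rw [← nsmul_eq_mul, ← Finset.sum_const]
    refine (Finset.sum_le_sum (g := fun f => Real.exp (s * x f) + Real.exp (-s * x f))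
      fun f hf => ?_).trans
      (Finset.sum_le_sum_of_subset_of_nonneg (Finset.subset_univ _) fun f _ _ => by positivity)
    have hf' : t ≤ |x f| := (Finset.mem_filter.1 hf).2
    have h4 : Real.exp (s * t) ≤ Real.exp (s * |x f|) := by gcongr
    have h5 := Real.exp_pos (s * x f)
    have h6 := Real.exp_pos (-s * x f)
    rcases abs_cases (x f) with ⟨h, _⟩ | ⟨h, _⟩ <;> rw [h] at h4
    · linarith
    · rw [mul_neg, ← neg_mul] at h4
      linarith
  rw [Finset.sum_add_distrib] at h3
  have h7 : ((Finset.univ.filter (fun f => t ≤ |x f|)).card : ℝ) * Real.exp (s * t) ≤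
      (n : ℝ) ^ m * (2 * Real.exp ((T.card : ℝ) / n * m * s ^ 2 - s * t)) * Real.exp (s * t) := by
    rw [mul_assoc, mul_assoc, ← Real.exp_add, sub_add_cancel]
    linarith
  exact le_of_mul_le_mul_right h7 (Real.exp_pos _)

/-! ### A local limit bound for the number of balls in a set of bins -/

theorem integral_exp_int_mul_I (j : ℤ) :
    ∫ θ in (-Real.pi)..Real.pi, Complex.exp (((j : ℂ) * Complex.I) * θ) =
      if j = 0 then (2 * Real.pi : ℂ) else 0 := by
  split_ifs with h
  · simp only [h, Int.cast_zero, zero_mul, Complex.exp_zero, intervalIntegral.integral_const,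
      Complex.real_smul]
    push_cast
    ring
  · rw [integral_exp_mul_complex (mul_ne_zero (by exact_mod_cast h) Complex.I_ne_zero),
      div_eq_zero_iff, sub_eq_zero]
    left
    rw [Complex.exp_eq_exp_iff_exists_int]
    refine ⟨j, ?_⟩
    push_cast
    ring

/-- The squared norm is `1 - 2p(1-p)(1 - cos θ)`; the bounds `cos θ ≤ 1 - 2θ²/π²` on `[-π, π]` and
`1 - x ≤ exp (-x)` finish. -/
theorem norm_one_sub_add_mul_exp_le {p θ : ℝ} (hp0 : 0 ≤ p) (hp1 : p ≤ 1) (hθ : |θ| ≤ Real.pi) :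
    ‖(1 - p : ℂ) + p * Complex.exp (θ * Complex.I)‖ ≤
      Real.exp (-(2 * (p * (1 - p)) / Real.pi ^ 2) * θ ^ 2) := by
  have h1 : ‖(1 - p : ℂ) + p * Complex.exp (θ * Complex.I)‖ ^ 2 =
      1 - 2 * (p * (1 - p)) * (1 - Real.cos θ) := by
    rw [← Complex.normSq_eq_norm_sq, Complex.normSq_apply]
    simp only [Complex.add_re, Complex.sub_re, Complex.one_re, Complex.ofReal_re, Complex.mul_re,
      Complex.exp_ofReal_mul_I_re, Complex.exp_ofReal_mul_I_im, Complex.ofReal_im, Complex.add_im,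
      Complex.sub_im, Complex.one_im, Complex.mul_im]
    have := Real.sin_sq_add_cos_sq θ
    linear_combination p ^ 2 * this
  refine le_of_sq_le_sq ?_ (Real.exp_pos _).le
  have hpq : 0 ≤ p * (1 - p) := mul_nonneg hp0 (by linarith)
  have h2 := Real.cos_le_one_sub_mul_cos_sq hθ
  rw [h1, ← Real.exp_nat_mul]
  have h3 : 2 * (p * (1 - p)) * (2 / Real.pi ^ 2 * θ ^ 2) ≤
      2 * (p * (1 - p)) * (1 - Real.cos θ) :=
    mul_le_mul_of_nonneg_left (by linarith) (by positivity)
  have h4 := Real.add_one_le_exp (-(2 * (p * (1 - p)) * (2 / Real.pi ^ 2 * θ ^ 2)))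
  have h5 : ((2 : ℕ) : ℝ) * (-(2 * (p * (1 - p)) / Real.pi ^ 2) * θ ^ 2) =
      -(2 * (p * (1 - p)) * (2 / Real.pi ^ 2 * θ ^ 2)) := by
    push_cast
    ring
  rw [h5]
  linarith

theorem integral_exp_neg_mul_sq_le {b : ℝ} (hb : 0 < b) :
    ∫ θ in (-Real.pi)..Real.pi, Real.exp (-b * θ ^ 2) ≤ Real.sqrt (Real.pi / b) := by
  rw [← integral_gaussian, intervalIntegral.integral_of_le (by linarith [Real.pi_pos])]
  exact MeasureTheory.setIntegral_le_integral (integrable_exp_neg_mul_sq hb)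
    (Filter.Eventually.of_forall fun θ => (Real.exp_pos _).le)

-- Fourier inversion: the generating function at `exp (iθ)` is integrated against `exp (-ikθ)`.
open Classical in
theorem card_setLoad_eq_integral {m n : ℕ} (T : Finset (Fin n)) (k : ℕ) :
    (2 * Real.pi : ℂ) * ((Finset.univ.filter (fun f : Fin m → Fin n => setLoad f T = k)).card : ℂ) =
      ∫ θ in (-Real.pi)..Real.pi, Complex.exp (-(k * θ : ℝ) * Complex.I) *
        ((n : ℂ) - T.card + T.card * Complex.exp (θ * Complex.I)) ^ m := by
  have h1 : ∀ θ : ℝ, Complex.exp (-(k * θ : ℝ) * Complex.I) *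
        ((n : ℂ) - T.card + T.card * Complex.exp (θ * Complex.I)) ^ m =
      ∑ f : Fin m → Fin n, Complex.exp ((((setLoad f T : ℤ) - k : ℤ) * Complex.I) * θ) := by
    intro θ
    rw [← sum_pow_setLoad, Finset.mul_sum]
    refine Finset.sum_congr rfl fun f _ => ?_
    rw [← Complex.exp_nat_mul, ← Complex.exp_add]
    congr 1
    push_cast
    ring
  simp only [h1]
  rw [intervalIntegral.integral_finsetSum
    (fun f _ => Continuous.intervalIntegrable (by fun_prop) _ _)]
  simp only [integral_exp_int_mul_I, sub_eq_zero, Nat.cast_inj]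
  rw [← Finset.sum_filter, Finset.sum_const, nsmul_eq_mul, mul_comm]

-- The inversion integral is bounded by the integral of the norm, which a Gaussian of rate `b` of
-- order `m p (1 - p)` dominates.
open Classical in
theorem card_setLoad_eq_le {m n : ℕ} (hn : 0 < n) (hm : 0 < m) (T : Finset (Fin n)) (k : ℕ)
    (h0 : 0 < T.card) (h1 : T.card < n) :
    ((Finset.univ.filter (fun f : Fin m → Fin n => setLoad f T = k)).card : ℝ) ≤
      (n : ℝ) ^ m / Real.sqrt (m * ((T.card : ℝ) / n * (1 - (T.card : ℝ) / n))) := by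
  have hn' : (0 : ℝ) < n := by exact_mod_cast hn
  have hm' : (0 : ℝ) < m := by exact_mod_cast hm
  have hpi := Real.pi_pos
  have hp0 : 0 < (T.card : ℝ) / n := div_pos (by exact_mod_cast h0) hn'
  have hp1 : (T.card : ℝ) / n < 1 := (div_lt_one hn').2 (by exact_mod_cast h1)
  have hT : (T.card : ℝ) = n * ((T.card : ℝ) / n) := (mul_div_cancel₀ _ hn'.ne').symm
  generalize (T.card : ℝ) / n = p at hp0 hp1 hT ⊢
  have hpq : 0 < p * (1 - p) := mul_pos hp0 (by linarith)
  obtain ⟨b, hb⟩ : ∃ b : ℝ, b = m * (2 * (p * (1 - p)) / Real.pi ^ 2) := ⟨_, rfl⟩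
  have hb0 : 0 < b := by rw [hb]; positivity
  have hbound : ∀ θ ∈ Set.Icc (-Real.pi) Real.pi,
      ‖Complex.exp (-(k * θ : ℝ) * Complex.I) *
        ((n : ℂ) - T.card + T.card * Complex.exp (θ * Complex.I)) ^ m‖ ≤
      (n : ℝ) ^ m * Real.exp (-b * θ ^ 2) := by
    intro θ hθ
    have e1 : ((n : ℂ) - T.card + T.card * Complex.exp (θ * Complex.I)) =
        n * ((1 - p : ℂ) + p * Complex.exp (θ * Complex.I)) := by
      have : (T.card : ℂ) = n * p := by exact_mod_cast hT
      rw [this]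
      ring
    have e2 : ‖Complex.exp (-(k * θ : ℝ) * Complex.I)‖ = 1 := by
      rw [← Complex.ofReal_neg, Complex.norm_exp_ofReal_mul_I]
    have e3 := norm_one_sub_add_mul_exp_le hp0.le hp1.le (abs_le.2 hθ)
    rw [norm_mul, e2, one_mul, e1, norm_pow, norm_mul, Complex.norm_natCast, mul_pow]
    refine mul_le_mul_of_nonneg_left ((pow_le_pow_left₀ (norm_nonneg _) e3 m).trans_eq ?_)
      (by positivity)
    rw [← Real.exp_nat_mul, hb]
    congr 1
    ring
  have h2 : 2 * Real.pi *
      ((Finset.univ.filter (fun f : Fin m → Fin n => setLoad f T = k)).card : ℝ) ≤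
      (n : ℝ) ^ m * Real.sqrt (Real.pi / b) := by
    have e := congrArg norm (card_setLoad_eq_integral (m := m) T k)
    rw [norm_mul, norm_mul, Complex.norm_natCast, Complex.norm_real, Complex.norm_ofNat,
      Real.norm_of_nonneg hpi.le] at e
    rw [e]
    refine (intervalIntegral.norm_integral_le_integral_norm (by linarith)).trans ?_
    refine (intervalIntegral.integral_mono_on (by linarith)
      (Continuous.intervalIntegrable (by fun_prop) _ _)
      (Continuous.intervalIntegrable (by fun_prop) _ _) hbound).trans ?_
    rw [intervalIntegral.integral_const_mul]
    exact mul_le_mul_of_nonneg_left (integral_exp_neg_mul_sq_le hb0) (by positivity)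
  -- After squaring and clearing denominators this is `π ≤ 8`.
  have h3 : Real.sqrt (Real.pi / b) ≤ 2 * Real.pi / Real.sqrt (m * (p * (1 - p))) := by
    refine Real.sqrt_le_iff.2 ⟨by positivity, ?_⟩
    rw [div_pow, Real.sq_sqrt (by positivity), hb, div_le_div_iff₀ (by positivity) (by positivity)]
    have h4 : (2 * Real.pi) ^ 2 * (m * (2 * (p * (1 - p)) / Real.pi ^ 2)) =
        8 * (m * (p * (1 - p))) := by
      field_simp
      ring
    rw [h4]
    exact mul_le_mul_of_nonneg_right (by linarith [Real.pi_le_four]) (by positivity)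
  have h5 : 2 * Real.pi *
      ((Finset.univ.filter (fun f : Fin m → Fin n => setLoad f T = k)).card : ℝ) ≤
      2 * Real.pi * ((n : ℝ) ^ m / Real.sqrt (m * (p * (1 - p)))) := by
    refine h2.trans ((mul_le_mul_of_nonneg_left h3 (by positivity)).trans_eq ?_)
    ring
  exact le_of_mul_le_mul_left h5 (by positivity)

/-! ### The expected Shapley value -/

/-- Passes from ranks to bins: an ordering of sorted agents becomes an ordering of bins through the
sorting permutation. -/
theorem coalitionWeight_sortedWeights {m n : ℕ} (f : Fin m → Fin n) (σ : Equiv.Perm (Fin n))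
    (ℓ : ℕ) : coalitionWeight (sortedWeights f) (initialSegment σ ℓ) =
      setLoad f (initialSegment (σ * (Tuple.sort (binLoad f))⁻¹) ℓ) := by
  rw [setLoad_eq_sum, Nat.cast_sum, coalitionWeight]
  refine Finset.sum_equiv (Tuple.sort (binLoad f)) (fun i => ?_) (fun i _ => rfl)
  simp [mem_initialSegment]

open Classical in
theorem shapley_sortedWeights_ge {m n : ℕ} [NeZero n] (f : Fin m → Fin n) {ℓ : ℕ}
    (hℓ0 : 0 < ℓ) (hℓ : ℓ < n) (q : ℝ) {D : ℝ} (hD : D ≤ (m : ℝ) / (2 * n))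
    (hf : ∀ i, |(binLoad f i : ℝ) - (m : ℝ) / n| < D) :
    1 / (n : ℝ) - 1 / ((n ! : ℝ) * ℓ) * ((Finset.univ.filter (fun τ : Equiv.Perm (Fin n) =>
      CriticalWeight q (2 * D) ((m : ℝ) / (2 * n)) (setLoad f (initialSegment τ ℓ)))).card : ℝ) ≤
        shapley (sortedWeights f) q 0 := by
  have hη : (m : ℝ) / (2 * n) + (m : ℝ) / (2 * n) = (m : ℝ) / n := by
    rw [mul_comm, ← div_div]
    exact add_halves _
  set π := Tuple.sort (binLoad f)
  -- Positions count from 0, so `r = ℓ - 1` makes the least agent the last of the first `ℓ`. Two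
  -- loads within `D` of `m/n` differ by less than `2D`.
  have h1 := shapley_ge (w := sortedWeights f) (fun i => Nat.cast_nonneg _) (q := q)
    (δ := 2 * D) (η := (m : ℝ) / (2 * n)) (i := 0) (r := ⟨ℓ - 1, by omega⟩) (s := ⟨ℓ, hℓ⟩)
    (fun j => Nat.cast_le.2 (Tuple.monotone_sort (binLoad f) (Fin.zero_le j)))
    (fun j => by
      have a1 := abs_lt.1 (hf (π j))
      have a2 := abs_lt.1 (hf (π 0))
      unfold sortedWeights
      linarith [a1.2, a2.1])
    (by
      have a2 := abs_lt.1 (hf (π 0))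
      unfold sortedWeights
      linarith [a2.1])
    (by simp; omega)
  refine le_trans (sub_le_sub_left ?_ _) h1
  simp only [coalitionWeight_sortedWeights]
  set Q : Finset (Fin n) → Prop := fun T =>
    CriticalWeight q (2 * D) ((m : ℝ) / (2 * n)) (setLoad f T)
  set r : Fin n := ⟨ℓ - 1, by omega⟩
  have h2 : (Finset.univ.filter (fun σ : Equiv.Perm (Fin n) => σ 0 = r ∧
      Q (initialSegment (σ * π⁻¹) ℓ))).card =
      (Finset.univ.filter (fun τ : Equiv.Perm (Fin n) => τ (π 0) = r ∧
        Q (initialSegment τ ℓ))).card := by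
    refine Finset.card_bij' (fun σ _ => σ * π⁻¹) (fun τ _ => τ * π) ?_ ?_ ?_ ?_
    · intro σ hσ
      simpa using hσ
    · intro τ hτ
      simpa [mul_assoc] using hτ
    · intro σ _
      simp
    · intro τ _
      simp
  have h3 := mul_card_position_eq Q (π 0) r (ℓ := ℓ) (by simp [r]; omega) hℓ.le
  -- Dropping the condition on `π 0`, the only trace of which bin is least, leaves an event about a
  -- segment chosen independently of `f`.
  have h4 : (Finset.univ.filter (fun τ : Equiv.Perm (Fin n) =>
        (τ (π 0) : ℕ) < ℓ ∧ Q (initialSegment τ ℓ))).card ≤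
      (Finset.univ.filter (fun τ : Equiv.Perm (Fin n) => Q (initialSegment τ ℓ))).card :=
    Finset.card_le_card (Finset.monotone_filter_right _ fun τ _ h => h.2)
  rw [← h3, ← h2] at h4
  have h5 : (ℓ : ℝ) * ((Finset.univ.filter (fun σ : Equiv.Perm (Fin n) => σ 0 = r ∧
      Q (initialSegment (σ * π⁻¹) ℓ))).card : ℝ) ≤
      ((Finset.univ.filter (fun τ : Equiv.Perm (Fin n) => Q (initialSegment τ ℓ))).card : ℝ) := by
    exact_mod_cast h4
  have hℓ' : (0 : ℝ) < ℓ := by exact_mod_cast hℓ0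
  have hfac : (0 : ℝ) < n ! := by exact_mod_cast n.factorial_pos
  calc _ = 1 / ((n ! : ℝ) * ℓ) * ((ℓ : ℝ) *
        ((Finset.univ.filter (fun σ : Equiv.Perm (Fin n) => σ 0 = r ∧
          Q (initialSegment (σ * π⁻¹) ℓ))).card : ℝ)) := by field_simp; rfl
    _ ≤ _ := mul_le_mul_of_nonneg_left h5 (by positivity)

/-! ### Probability that a fixed set of bins has critical load -/

open Classical in
theorem card_setLoad_mem_Ico_le {m n : ℕ} (hn : 0 < n) (hm : 0 < m) (T : Finset (Fin n))
    {γ q δ : ℝ} (hγ : 0 < γ) (h0 : γ ≤ (T.card : ℝ) / n) (h1 : (T.card : ℝ) / n ≤ 1 - γ)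
    (hq : 0 ≤ q) (hδ : 0 ≤ δ) :
    ((Finset.univ.filter (fun f : Fin m → Fin n =>
      q - δ ≤ setLoad f T ∧ (setLoad f T : ℝ) < q)).card : ℝ) ≤
      (n : ℝ) ^ m * ((δ + 1) / (γ * Real.sqrt m)) := by
  have hn' : (0 : ℝ) < n := by exact_mod_cast hn
  have hm' : (0 : ℝ) < m := by exact_mod_cast hm
  have hT0 : 0 < T.card := by
    have h : 0 < (T.card : ℝ) / n := hγ.trans_le h0
    exact_mod_cast (div_pos_iff_of_pos_right hn').1 h
  have hT1 : T.card < n := by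
    have h : (T.card : ℝ) / n < 1 := by linarith
    exact_mod_cast (div_lt_one hn').1 h
  have hpt : ∀ k : ℕ, ((Finset.univ.filter (fun f : Fin m → Fin n => setLoad f T = k)).card : ℝ) ≤
      (n : ℝ) ^ m / (γ * Real.sqrt m) := by
    intro k
    refine (card_setLoad_eq_le hn hm T k hT0 hT1).trans ?_
    -- Both `p` and `1 - p` are at least `γ`, so the standard deviation is at least `γ√m`.
    refine div_le_div_of_nonneg_left (by positivity) (by positivity) ?_
    refine Real.le_sqrt_of_sq_le ?_
    rw [mul_pow, Real.sq_sqrt hm'.le, mul_comm]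
    exact mul_le_mul_of_nonneg_left (by nlinarith) hm'.le
  set I := Finset.Ico ⌈q - δ⌉₊ ⌈q⌉₊
  -- The natural ceiling truncates `q - δ` at 0 when it is negative, which is harmless because loads
  -- are nonnegative.
  have hI : (I.card : ℝ) ≤ δ + 1 := by
    rw [Nat.card_Ico]
    rcases le_total ⌈q⌉₊ ⌈q - δ⌉₊ with h | h
    · rw [Nat.sub_eq_zero_of_le h]
      push_cast
      linarith
    · rw [Nat.cast_sub h]
      linarith [Nat.ceil_lt_add_one hq, Nat.le_ceil (q - δ)]
  have hsub : Finset.univ.filter (fun f : Fin m → Fin n =>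
      q - δ ≤ setLoad f T ∧ (setLoad f T : ℝ) < q) ⊆
      I.biUnion (fun k => Finset.univ.filter (fun f : Fin m → Fin n => setLoad f T = k)) := by
    intro f hf
    have hf' := (Finset.mem_filter.1 hf).2
    refine Finset.mem_biUnion.2 ⟨setLoad f T, Finset.mem_Ico.2
      ⟨Nat.ceil_le.2 hf'.1, Nat.lt_ceil.2 hf'.2⟩, by simp⟩
  calc _ ≤ ((∑ k ∈ I,
        (Finset.univ.filter (fun f : Fin m → Fin n => setLoad f T = k)).card : ℕ) : ℝ) := by
        exact_mod_cast (Finset.card_le_card hsub).trans Finset.card_biUnion_le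
    _ ≤ I.card * ((n : ℝ) ^ m / (γ * Real.sqrt m)) := by
        push_cast
        rw [← nsmul_eq_mul, ← Finset.sum_const]
        exact Finset.sum_le_sum fun k _ => hpt k
    _ ≤ (δ + 1) * ((n : ℝ) ^ m / (γ * Real.sqrt m)) :=
        mul_le_mul_of_nonneg_right hI (by positivity)
    _ = _ := by ring

open Classical in
theorem card_criticalWeight_le {m n : ℕ} (hn : 0 < n) (hm : 0 < m) (T : Finset (Fin n))
    {γ δ : ℝ} (hγ : 0 < γ) (h0 : γ ≤ (T.card : ℝ) / n) (h1 : (T.card : ℝ) / n ≤ 1 - γ)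
    (hδ : 0 ≤ δ) :
    ((Finset.univ.filter (fun f : Fin m → Fin n =>
      CriticalWeight ((T.card : ℝ) * ((m : ℝ) / n)) δ ((m : ℝ) / (2 * n)) (setLoad f T))).card : ℝ)
      ≤ (n : ℝ) ^ m * ((δ + 1) / (γ * Real.sqrt m) +
        2 * Real.exp (-((m : ℝ) / (16 * (n : ℝ) ^ 2)))) := by
  have hn1 : (1 : ℝ) ≤ n := by exact_mod_cast hn
  have hn' : (0 : ℝ) < n := by linarith
  have hm' : (0 : ℝ) < m := by exact_mod_cast hm
  have hA := card_setLoad_mem_Ico_le hn hm T hγ h0 h1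
    (q := (T.card : ℝ) * ((m : ℝ) / n)) (by positivity) hδ
  -- With `s = 1/(4n)` the exponent is `(p - 2) m / (16n²)`, and `p ≤ 1`.
  have hB := card_setLoad_tail_le (m := m) hn T (s := 1 / (4 * n)) (t := (m : ℝ) / (2 * n))
    (by positivity) (by rw [div_le_one (by positivity)]; linarith)
  have hexp : (T.card : ℝ) / n * m * (1 / (4 * n)) ^ 2 - 1 / (4 * n) * ((m : ℝ) / (2 * n)) ≤
      -((m : ℝ) / (16 * (n : ℝ) ^ 2)) := by
    have e1 : (T.card : ℝ) / n * m * (1 / (4 * n)) ^ 2 =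
        (T.card : ℝ) / n * ((m : ℝ) / (16 * (n : ℝ) ^ 2)) := by
      field_simp
      ring
    have e2 : (1 / (4 * n)) * ((m : ℝ) / (2 * n)) = 2 * ((m : ℝ) / (16 * (n : ℝ) ^ 2)) := by
      field_simp
      ring
    have e3 : 0 ≤ (m : ℝ) / (16 * (n : ℝ) ^ 2) := by positivity
    rw [e1, e2]
    nlinarith
  have hB' := hB.trans (mul_le_mul_of_nonneg_left (mul_le_mul_of_nonneg_left
    (Real.exp_le_exp.2 hexp) zero_le_two) (by positivity))
  have hq : (T.card : ℝ) / n * m = (T.card : ℝ) * ((m : ℝ) / n) := by ring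
  rw [hq] at hB'
  rw [mul_add]
  refine le_trans ?_ (add_le_add hA hB')
  rw [← Nat.cast_add, Nat.cast_le]
  refine le_trans (Finset.card_le_card fun f hf => ?_) (Finset.card_union_le _ _)
  simpa only [CriticalWeight, Finset.mem_union, Finset.mem_filter, Finset.mem_univ,
    true_and] using (Finset.mem_filter.1 hf).2

open Classical in
theorem card_exists_binLoad_le {m n : ℕ} (hn : 0 < n) {s D : ℝ} (hs0 : 0 ≤ s) (hs : s ≤ 1) :
    ((Finset.univ.filter (fun f : Fin m → Fin n =>
      ¬ ∀ i, |(binLoad f i : ℝ) - (m : ℝ) / n| < D)).card : ℝ) ≤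
      (n : ℝ) ^ m * (n * (2 * Real.exp ((m : ℝ) / n * s ^ 2 - s * D))) := by
  have h1 : ∀ i : Fin n, ((Finset.univ.filter (fun f : Fin m → Fin n =>
      D ≤ |(binLoad f i : ℝ) - (m : ℝ) / n|)).card : ℝ) ≤
      (n : ℝ) ^ m * (2 * Real.exp ((m : ℝ) / n * s ^ 2 - s * D)) := by
    intro i
    have h := card_setLoad_tail_le (m := m) hn {i} (s := s) (t := D) hs0 hs
    have e : (1 : ℝ) / n * m = m / n := by ring
    simpa only [Finset.card_singleton, Nat.cast_one, e, setLoad_singleton] using h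
  have hsub : Finset.univ.filter (fun f : Fin m → Fin n =>
      ¬ ∀ i, |(binLoad f i : ℝ) - (m : ℝ) / n| < D) ⊆
      Finset.univ.biUnion (fun i => Finset.univ.filter (fun f : Fin m → Fin n =>
        D ≤ |(binLoad f i : ℝ) - (m : ℝ) / n|)) := by
    intro f hf
    have hf' := (Finset.mem_filter.1 hf).2
    push Not at hf'
    obtain ⟨i, hi⟩ := hf'
    exact Finset.mem_biUnion.2 ⟨i, Finset.mem_univ _, Finset.mem_filter.2 ⟨Finset.mem_univ _, hi⟩⟩
  calc _ ≤ ((∑ i : Fin n, (Finset.univ.filter (fun f : Fin m → Fin n =>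
        D ≤ |(binLoad f i : ℝ) - (m : ℝ) / n|)).card : ℕ) : ℝ) := by
        exact_mod_cast (Finset.card_le_card hsub).trans Finset.card_biUnion_le
    _ ≤ ∑ _i : Fin n, (n : ℝ) ^ m * (2 * Real.exp ((m : ℝ) / n * s ^ 2 - s * D)) := by
        push_cast
        exact Finset.sum_le_sum fun i _ => h1 i
    _ = _ := by
        rw [Finset.sum_const, Finset.card_univ, Fintype.card_fin, nsmul_eq_mul]
        ring

/-! ### Averaging over throws and orderings -/

open Classical in
theorem ballsBinsExpectation_shapley_ge {m n : ℕ} [NeZero n] (hm : 0 < m) {ℓ : ℕ} {γ s D : ℝ}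
    (hγ : 0 < γ) (h0 : γ ≤ (ℓ : ℝ) / n) (h1 : (ℓ : ℝ) / n ≤ 1 - γ)
    (hs0 : 0 ≤ s) (hs : s ≤ 1) (hD0 : 0 ≤ D) (hD : D ≤ (m : ℝ) / (2 * n)) :
    1 / (n : ℝ) * (1 - n * (2 * Real.exp ((m : ℝ) / n * s ^ 2 - s * D)) -
      1 / γ * ((2 * D + 1) / (γ * Real.sqrt m) +
        2 * Real.exp (-((m : ℝ) / (16 * (n : ℝ) ^ 2))))) ≤
      ballsBinsExpectation (fun f : Fin m → Fin n =>
        shapley (sortedWeights f) ((ℓ : ℝ) * ((m : ℝ) / n)) 0) := by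
  have hn : 0 < n := Nat.pos_of_neZero n
  have hn' : (0 : ℝ) < n := by exact_mod_cast hn
  have hℓ0 : (0 : ℝ) < ℓ := (div_pos_iff_of_pos_right hn').1 (hγ.trans_le h0)
  have hℓ1 : (ℓ : ℝ) < n := (div_lt_one hn').1 (by linarith)
  have hℓn : ℓ < n := by exact_mod_cast hℓ1
  have hfac : (0 : ℝ) < n ! := by exact_mod_cast n.factorial_pos
  set q : ℝ := (ℓ : ℝ) * ((m : ℝ) / n) with hq
  set B : ℝ := n * (2 * Real.exp ((m : ℝ) / n * s ^ 2 - s * D))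
  set A : ℝ := (2 * D + 1) / (γ * Real.sqrt m) + 2 * Real.exp (-((m : ℝ) / (16 * (n : ℝ) ^ 2)))
    with hA
  have hA0 : 0 ≤ A := by positivity
  set C : (Fin m → Fin n) → Equiv.Perm (Fin n) → Prop := fun f τ =>
    CriticalWeight q (2 * D) ((m : ℝ) / (2 * n)) (setLoad f (initialSegment τ ℓ))
  have hpt : ∀ f : Fin m → Fin n,
      1 / (n : ℝ) - 1 / ((n ! : ℝ) * ℓ) * ((Finset.univ.filter (fun τ => C f τ)).card : ℝ) -
        1 / (n : ℝ) * (if ¬ ∀ i, |(binLoad f i : ℝ) - (m : ℝ) / n| < D then (1 : ℝ) else 0) ≤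
      shapley (sortedWeights f) q 0 := by
    intro f
    by_cases hf : ∀ i, |(binLoad f i : ℝ) - (m : ℝ) / n| < D
    · rw [if_neg (not_not.2 hf), mul_zero, sub_zero]
      exact shapley_sortedWeights_ge f (by exact_mod_cast hℓ0) hℓn q hD hf
    -- On throws with an atypical load only nonnegativity of the Shapley value is used.
    · rw [if_pos hf, mul_one]
      have h2 := shapley_nonneg (w := sortedWeights f) (fun i => Nat.cast_nonneg _) q 0
      have h3 : 0 ≤ 1 / ((n ! : ℝ) * ℓ) *
        ((Finset.univ.filter (fun τ => C f τ)).card : ℝ) := by positivity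
      linarith
  have hcrit : ∑ f : Fin m → Fin n, ((Finset.univ.filter (fun τ => C f τ)).card : ℝ) ≤
      (n ! : ℝ) * ((n : ℝ) ^ m * A) := by
    -- Exchanging the sums fixes the ordering, hence the set of bins, before averaging over throws.
    have e : ∑ f : Fin m → Fin n, ((Finset.univ.filter (fun τ => C f τ)).card : ℝ) =
        ∑ τ : Equiv.Perm (Fin n), ((Finset.univ.filter (fun f => C f τ)).card : ℝ) := by
      simp only [Finset.card_filter, Nat.cast_sum]
      exact Finset.sum_comm
    rw [e]
    refine (Finset.sum_le_sum (g := fun _ => (n : ℝ) ^ m * A) fun τ _ => ?_).trans_eq ?_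
    · have hc := card_initialSegment τ hℓn.le
      have h := card_criticalWeight_le hn hm (initialSegment τ ℓ) hγ (by rwa [hc]) (by rwa [hc])
        (δ := 2 * D) (by positivity)
      rwa [hc] at h
    · rw [Finset.sum_const, Finset.card_univ, Fintype.card_perm, Fintype.card_fin, nsmul_eq_mul]
  have hbad := card_exists_binLoad_le (m := m) hn (D := D) hs0 hs
  have hsum := Finset.sum_le_sum (fun f (_ : f ∈ (Finset.univ : Finset (Fin m → Fin n))) => hpt f)
  rw [Finset.sum_sub_distrib, Finset.sum_sub_distrib, ← Finset.mul_sum, ← Finset.mul_sum,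
    Finset.sum_boole, Finset.sum_const, Finset.card_univ, Fintype.card_fun, Fintype.card_fin,
    Fintype.card_fin, nsmul_eq_mul, Nat.cast_pow] at hsum
  have hpow : (0 : ℝ) < (n : ℝ) ^ m := by positivity
  have hc1 : 1 / ((n ! : ℝ) * ℓ) *
      ∑ f : Fin m → Fin n, ((Finset.univ.filter (fun τ => C f τ)).card : ℝ) ≤
      (n : ℝ) ^ m * (1 / (n : ℝ) * (1 / γ * A)) := by
    refine (mul_le_mul_of_nonneg_left hcrit (by positivity)).trans ?_
    have e : 1 / ((n ! : ℝ) * ℓ) * ((n ! : ℝ) * ((n : ℝ) ^ m * A)) =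
        (n : ℝ) ^ m * (1 / ℓ * A) := by field_simp
    rw [e, ← mul_assoc (1 / (n : ℝ))]
    refine mul_le_mul_of_nonneg_left (mul_le_mul_of_nonneg_right ?_ hA0) hpow.le
    rw [one_div_mul_one_div]
    refine one_div_le_one_div_of_le (by positivity) ?_
    rw [mul_comm]
    exact (le_div_iff₀ hn').1 h0
  have hc2 := mul_le_mul_of_nonneg_left hbad (one_div_nonneg.2 hn'.le)
  unfold ballsBinsExpectation
  rw [one_div ((n : ℝ) ^ m), inv_mul_eq_div, le_div_iff₀ hpow]
  refine le_trans ?_ hsum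
  have e : 1 / (n : ℝ) * (1 - B - 1 / γ * A) * (n : ℝ) ^ m =
      (n : ℝ) ^ m * (1 / (n : ℝ)) - (n : ℝ) ^ m * (1 / (n : ℝ) * (1 / γ * A)) -
        1 / (n : ℝ) * ((n : ℝ) ^ m * B) := by ring
  rw [e]
  linarith

/-! ### Choice of the parameters -/

theorem mainTheorem4 (γ : ℝ) (hγ : 0 < γ) :
    ∃ K : ℝ, ∀ c : ℝ, 0 < c → ∃ N : ℕ, ∀ (n : ℕ) [NeZero n], N ≤ n →
      ∀ m : ℕ, c * (n : ℝ) ^ 3 ≤ (m : ℝ) →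
      ∀ ℓ : ℕ, 1 ≤ ℓ → ℓ ≤ n → γ ≤ (ℓ : ℝ) / n → (ℓ : ℝ) / n ≤ 1 - γ →
        1 / (n : ℝ) - K * Real.sqrt (Real.log n / (n : ℝ) ^ 3) ≤
          ballsBinsExpectation (fun f : Fin m → Fin n =>
            shapley (sortedWeights f) ((ℓ : ℝ) * ((m : ℝ) / n)) 0) := by
  -- The first 1 pays for atypical loads and the factor `1/γ` for `n/ℓ`. In `7/γ`, 6 comes from the
  -- window `2D` and 1 from rounding; the last 1 is the Chernoff tail. In `N`, `36/c` ensures `m ≥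
  -- 36n²`, `(32/c)²` serves the tail, and 4 gives `log n ≥ 1` and `4/n ≤ 1`.
  refine ⟨1 + 1 / γ * (7 / γ + 1), fun c hc => ⟨⌈36 / c + (32 / c) ^ 2 + 4⌉₊, ?_⟩⟩
  intro n _ hN m hm ℓ _ _ h0 h1
  have hN' : 36 / c + (32 / c) ^ 2 + 4 ≤ (n : ℝ) := Nat.ceil_le.1 hN
  have hc36 : 0 < 36 / c := by positivity
  have hc32 : 0 < (32 / c) ^ 2 := by positivity
  have hn4 : (4 : ℝ) ≤ n := by linarith
  have hn : (0 : ℝ) < n := by linarith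
  have hcn : 36 ≤ c * n := by
    rw [mul_comm]
    exact (div_le_iff₀ hc).1 (by linarith)
  have hmn : 36 * (n : ℝ) ^ 2 ≤ m := by nlinarith [sq_nonneg (n : ℝ)]
  have hm0 : (0 : ℝ) < m := by nlinarith
  have hlog1 : 1 ≤ Real.log n := by
    rw [Real.le_log_iff_exp_le hn]
    linarith [Real.exp_one_lt_three]
  have hlogn : Real.log n ≤ n := (Real.log_le_sub_one_of_pos hn).trans (by linarith)
  set L : ℝ := Real.sqrt (Real.log n / n) with hL
  have hL0 : 0 ≤ L := Real.sqrt_nonneg _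
  have hL2 : n * L ^ 2 = Real.log n := by
    rw [hL, Real.sq_sqrt (by positivity)]
    field_simp
  have hrhs : Real.sqrt (Real.log n / (n : ℝ) ^ 3) = 1 / n * L := by
    rw [show Real.log n / (n : ℝ) ^ 3 = (1 / n) ^ 2 * (Real.log n / n) by field_simp,
      Real.sqrt_mul (by positivity), Real.sqrt_sq (by positivity)]
  -- Since `log n ≥ 1`, every error of size at most `1/√n` is absorbed in `L`.
  have hle_L : ∀ x : ℝ, n * x ^ 2 ≤ 1 → x ≤ L := by
    intro x hx
    refine Real.le_sqrt_of_sq_le ((le_div_iff₀ hn).2 ?_)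
    linarith
  set R : ℝ := Real.sqrt m with hR
  have hR2 : R ^ 2 = m := Real.sq_sqrt hm0.le
  have hR0 : 0 < R := Real.sqrt_pos.2 hm0
  have hnL : 6 * (n * L) ≤ R := by
    refine le_of_sq_le_sq ?_ hR0.le
    rw [hR2]
    nlinarith
  have hD : 3 * R * L ≤ (m : ℝ) / (2 * n) := by
    rw [le_div_iff₀ (by positivity), ← hR2]
    nlinarith
  -- With these `s` and `D` the exponent for a single bin is `log n - 3 log n = -2 log n`, so the
  -- union bound gives `2/n`.
  have key := ballsBinsExpectation_shapley_ge (m := m) (n := n) (by exact_mod_cast hm0) hγ h0 h1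
    (s := n * L / R) (D := 3 * R * L) (by positivity)
    (by rw [div_le_one hR0]; nlinarith [mul_nonneg hn.le hL0]) (by positivity) hD
  refine le_trans ?_ key
  rw [hrhs]
  have hexp : (n : ℝ) * (2 * Real.exp ((m : ℝ) / n * (n * L / R) ^ 2 - n * L / R * (3 * R * L))) ≤
      L := by
    have e : (m : ℝ) / n * (n * L / R) ^ 2 - n * L / R * (3 * R * L) = -(2 * (n * L ^ 2)) := by
      rw [← hR2]
      field_simp
      ring
    rw [e, hL2, Real.exp_neg, two_mul (Real.log n), Real.exp_add, Real.exp_log hn]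
    refine hle_L _ ?_
    rw [show (n : ℝ) * (n * (2 * ((n : ℝ) * n)⁻¹)) ^ 2 = 4 / n by field_simp; norm_num,
      div_le_one hn]
    exact hn4
  have hR1 : 1 / R ≤ L := by
    refine hle_L _ ?_
    rw [div_pow, hR2, one_pow, mul_one_div, div_le_one hm0]
    nlinarith
  have htail : 2 * Real.exp (-((m : ℝ) / (16 * (n : ℝ) ^ 2))) ≤ L := by
    have h2 : c * n / 16 ≤ (m : ℝ) / (16 * (n : ℝ) ^ 2) := by
      rw [div_le_div_iff₀ (by norm_num) (by positivity)]
      nlinarith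
    -- The crude bound `exp (-x) ≤ 1/x` is enough, because `m ≥ c n³` makes `x` at least linear in
    -- `n`.
    have h3 : Real.exp (-((m : ℝ) / (16 * (n : ℝ) ^ 2))) ≤ 16 / (c * n) := by
      rw [Real.exp_neg, show 16 / (c * n) = (c * n / 16)⁻¹ from (inv_div _ _).symm]
      refine inv_anti₀ (by positivity) ?_
      linarith [Real.add_one_le_exp ((m : ℝ) / (16 * (n : ℝ) ^ 2))]
    have h4 : 32 / c * (1 / n) ≤ L := by
      refine hle_L _ ?_
      rw [show (n : ℝ) * (32 / c * (1 / n)) ^ 2 = (32 / c) ^ 2 / n by field_simp, div_le_one hn]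
      linarith
    calc _ ≤ 2 * (16 / (c * n)) := by linarith
      _ = 32 / c * (1 / n) := by field_simp; norm_num
      _ ≤ L := h4
  have hmid : (2 * (3 * R * L) + 1) / (γ * R) ≤ 7 / γ * L := by
    have e : (2 * (3 * R * L) + 1) / (γ * R) = 1 / γ * (6 * L + 1 / R) := by
      field_simp
      ring
    have e' : 7 / γ * L = 1 / γ * (6 * L + L) := by ring
    rw [e, e']
    exact mul_le_mul_of_nonneg_left (by linarith) (by positivity)
  have hsum : 1 / γ * ((2 * (3 * R * L) + 1) / (γ * R) +
      2 * Real.exp (-((m : ℝ) / (16 * (n : ℝ) ^ 2)))) ≤ 1 / γ * (7 / γ * L + L) :=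
    mul_le_mul_of_nonneg_left (add_le_add hmid htail) (by positivity)
  calc 1 / (n : ℝ) - (1 + 1 / γ * (7 / γ + 1)) * (1 / n * L)
      = 1 / (n : ℝ) * (1 - L - 1 / γ * (7 / γ * L + L)) := by ring
    _ ≤ _ := mul_le_mul_of_nonneg_left (by linarith) (by positivity)
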